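/- Let $p\ge 1$, $\xi\in\mathbb{R}^p$, let $\Omega$ be a real symmetric positive definite $p\times p$ matrix, put $\omega=\mathrm{diag}(\sqrt{\Omega_{11}},\dots,\sqrt{\Omega_{pp}})$ and $\bar\Omega=\omega^{-1}\Omega\,\omega^{-1}$, and let $\alpha\in\mathbb{R}^p$, $\alpha\neq 0$. Let $H$ be a probability distribution on $[0,\infty)$ that is not concentrated at $0$. Let $X\sim SMSN_p(\xi,\Omega,\alpha,H)$, that is, $X$ is distributed as $\xi+\omega SZ$, where $S\sim H$ is independent of the normalized skew-normal vector $Z$ with density $z\mapsto 2\,\phi_p(z;\bar\Omega)\,\Phi(\alpha'z)$ on $\mathbb{R}^p$; here $\phi_p(\cdot\,;\bar\Omega)$ is the density of $N_p(0,\bar\Omega)$ and $\Phi$ is the distribution function of $N(0,1)$. Suppose that $E(S^3)<\infty$ and $$\frac{4}{\pi}\,\bigl(E(S)\bigr)^2\ \ge\ E(S^2).$$ Let $\Sigma$ be the covariance matrix of $X$, let $\mathbb{S}_p^*=\{d\in\mathbb{R}^p: d'\Sigma d=1\}$, and for a real random variable $Y$ with mean $\mu_Y$ and standard deviation $\sigma_Y$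 let $\gamma_1(Y)=\Bigl(E\Bigl[\bigl(\tfrac{Y-\mu_Y}{\sigma_Y}\bigr)^3\Bigr]\Bigr)^2$. Then the maximum $\max_{d\in\mathbb{S}_p^*}\gamma_1(d'X)$ is attained at the direction of the shape vector $\eta=\omega^{-1}\alpha$: the set $\mathbb{S}_p^*$ contains a scalar multiple of $\eta$, and a vector $d\in\mathbb{S}_p^*$ maximizes $d\mapsto\gamma_1(d'X)$ over $\mathbb{S}_p^*$ if and only if $d$ is a scalar multiple of $\eta$. -/

import Mathlib

open MeasureTheory ProbabilityTheory
open scoped Matrix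

noncomputable section

namespace SMSN

variable {p : ℕ}

/-- The density `φ_p(x; Σ)` of the `p`-dimensional normal law with zero mean and covariance
matrix `Σ` (nonsingular). -/
def normalDensity (S : Matrix (Fin p) (Fin p) ℝ) (x : Fin p → ℝ) : ℝ :=
  (Real.sqrt ((2 * Real.pi) ^ p * S.det))⁻¹ * Real.exp (-(x ⬝ᵥ (S⁻¹ *ᵥ x)) / 2)

/-- `Φ`, the distribution function of a standard `N(0,1)` variable. -/
def stdNormalCDF (x : ℝ) : ℝ := cdf (gaussianReal 0 1) x

/-- The normalized skew-normal law `SN_p(0, R, α)` on `ℝ^p`: the law with Lebesgue density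
`z ↦ 2 φ_p(z; R) Φ(α' z)`, where `R` is a correlation matrix. -/
def skewNormal (R : Matrix (Fin p) (Fin p) ℝ) (α : Fin p → ℝ) : Measure (Fin p → ℝ) :=
  (volume : Measure (Fin p → ℝ)).withDensity fun z =>
    ENNReal.ofReal (2 * normalDensity R z * stdNormalCDF (α ⬝ᵥ z))

/-- The diagonal scale matrix `ω = (Ω ⊙ I_p)^{1/2}`. -/
def scaleDiag (Om : Matrix (Fin p) (Fin p) ℝ) : Matrix (Fin p) (Fin p) ℝ :=
  Matrix.diagonal fun i => Real.sqrt (Om i i)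

/-- The correlation matrix `ω⁻¹ Ω ω⁻¹` associated with the scale matrix `Ω`. -/
def corrMatrix (Om : Matrix (Fin p) (Fin p) ℝ) : Matrix (Fin p) (Fin p) ℝ :=
  (scaleDiag Om)⁻¹ * Om * (scaleDiag Om)⁻¹

/-- The law `SMSN_p(ξ, Ω, α, H)`: the law of `ξ + ω S Z`, where `S ∼ H` and
`Z ∼ SN_p(0, ω⁻¹ Ω ω⁻¹, α)` are independent. -/
def law (ξ : Fin p → ℝ) (Om : Matrix (Fin p) (Fin p) ℝ) (α : Fin p → ℝ) (H : Measure ℝ) :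
    Measure (Fin p → ℝ) :=
  (H.prod (skewNormal (corrMatrix Om) α)).map fun q => ξ + scaleDiag Om *ᵥ (q.1 • q.2)

/-- The shape vector `η = ω⁻¹ α`. -/
def shape (Om : Matrix (Fin p) (Fin p) ℝ) (α : Fin p → ℝ) : Fin p → ℝ :=
  (scaleDiag Om)⁻¹ *ᵥ α

variable {E : Type*} [MeasurableSpace E]

/-- The covariance matrix of a random vector. -/
def covMatrix (P : Measure E) (X : E → Fin p → ℝ) : Matrix (Fin p) (Fin p) ℝ :=
  Matrix.of fun i j => covariance (fun e => X e i) (fun e => X e j) P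

/-- The skewness index `γ₁(Y) = (E[((Y - μ_Y) / σ_Y)³])²` of a random variable. -/
def skewness (P : Measure E) (Y : E → ℝ) : ℝ :=
  (∫ e, ((Y e - ∫ e', Y e' ∂P) / Real.sqrt (variance Y P)) ^ 3 ∂P) ^ 2

/-- The set of directions `S_p^* = {d : d' Σ d = 1}`, with `Σ` the covariance matrix of `X`. -/
def directions (P : Measure E) (X : E → Fin p → ℝ) : Set (Fin p → ℝ) :=
  {d | d ⬝ᵥ (covMatrix P X *ᵥ d) = 1}

end SMSN

end

noncomputable section

namespace SMSN

variable {p : ℕ}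

/-! Write R for the correlation matrix, a = ωd, v = a'Ra, k = α'Rα and m = a'Rα / √(1+k). The
projection a'Z of the skew-normal vector has the law of T + m|U|, with U standard normal and T an
independent centred normal of variance v - m² (`map_dotProduct_skewNormal`). So the first three
moments of d'X depend on d only through v and m (`projection_moments`).

Let s₁, s₂, s₃ be the moments of S and b = √(2/π). The constraint Var(d'X) = 1 reads s₂v = 1 +
b²s₁²m². Eliminating v makes s₂ times the third central moment equal to b m (A + B m²), with A =
3(s₃ - s₁s₂) and B = s₃(3b²s₁² - s₂) - b²s₁³s₂. The moment condition, which says s₂ ≤ 2b²s₁², makes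
A and B nonnegative and not both zero (`skewness_coeff_nonneg`), so the squared skewness is strictly
increasing in m² (`strictMonoOn_mul_sq`).

It remains to maximize m² under the constraint. Cauchy–Schwarz for R gives m²(1+k) ≤ vk, with
equality exactly when a is a multiple of α (`dotProduct_mulVec_sq_le`), that is, when d is a
multiple of η. -/

/-! ### Skew-normal integrals as standard Gaussian integrals -/

/-- The standard Gaussian measure on `ℝ^p`. -/
abbrev stdNormal (p : ℕ) : Measure (Fin p → ℝ) := Measure.pi fun _ => gaussianReal 0 1

lemma stdNormal_eq_withDensity :
    stdNormal p = volume.withDensity fun x =>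
      ENNReal.ofReal (∏ i, gaussianPDFReal 0 1 (x i)) := by
  refine Measure.pi_eq fun s hs => ?_
  have hind : ∀ x : Fin p → ℝ, (Set.univ.pi s).indicator
      (fun x => ∏ i, gaussianPDFReal 0 1 (x i)) x
      = ∏ i, (s i).indicator (gaussianPDFReal 0 1) (x i) := by
    intro x
    by_cases hx : x ∈ Set.univ.pi s
    · rw [Set.indicator_of_mem hx]
      exact Finset.prod_congr rfl fun i _ => (Set.indicator_of_mem (hx i trivial) _).symm
    · rw [Set.indicator_of_notMem hx]
      simp only [Set.mem_pi, Set.mem_univ, true_implies, not_forall] at hx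
      obtain ⟨i, hi⟩ := hx
      exact (Finset.prod_eq_zero (Finset.mem_univ i) (Set.indicator_of_notMem hi _)).symm
  have hint : ∀ i, Integrable ((s i).indicator (gaussianPDFReal 0 1)) volume := fun i =>
    (integrable_gaussianPDFReal 0 1).indicator (hs i)
  rw [withDensity_apply _ (MeasurableSet.univ_pi hs),
    ← lintegral_indicator (MeasurableSet.univ_pi hs)]
  have : ∀ x : Fin p → ℝ, (Set.univ.pi s).indicator
      (fun x => ENNReal.ofReal (∏ i, gaussianPDFReal 0 1 (x i))) x
      = ENNReal.ofReal (∏ i, (s i).indicator (gaussianPDFReal 0 1) (x i)) := by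
    intro x
    rw [← hind]
    by_cases hx : x ∈ Set.univ.pi s <;> simp [Set.indicator_of_mem, Set.indicator_of_notMem, hx]
  simp_rw [this]
  have hnn : ∀ i x, 0 ≤ (s i).indicator (gaussianPDFReal 0 1) x := fun i x =>
    Set.indicator_nonneg (fun _ _ => gaussianPDFReal_nonneg _ _ _) _
  rw [← ofReal_integral_eq_lintegral_ofReal, volume_pi, integral_fintype_prod_eq_prod,
    ENNReal.ofReal_prod_of_nonneg fun i _ => integral_nonneg (hnn i)]
  · refine Finset.prod_congr rfl fun i _ => ?_
    rw [integral_indicator (hs i), gaussianReal_apply_eq_integral _ one_ne_zero]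
  · exact Integrable.fintype_prod_dep hint
  · exact Filter.Eventually.of_forall fun x => Finset.prod_nonneg fun i _ => hnn i _

lemma normalDensity_nonneg (S : Matrix (Fin p) (Fin p) ℝ) (x : Fin p → ℝ) :
    0 ≤ normalDensity S x := by
  unfold normalDensity; positivity

@[fun_prop]
lemma measurable_normalDensity (S : Matrix (Fin p) (Fin p) ℝ) : Measurable (normalDensity S) := by
  have : Continuous (normalDensity S) := by unfold normalDensity; fun_prop
  exact this.measurable

lemma normalDensity_mulVec (A : Matrix (Fin p) (Fin p) ℝ) (hA : A.det ≠ 0) (w : Fin p → ℝ) :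
    |A.det| * normalDensity (A * Aᵀ) (A *ᵥ w) = ∏ i, gaussianPDFReal 0 1 (w i) := by
  have hu : IsUnit A.det := isUnit_iff_ne_zero.2 hA
  have hq : (A *ᵥ w) ⬝ᵥ ((A * Aᵀ)⁻¹ *ᵥ (A *ᵥ w)) = w ⬝ᵥ w := by
    rw [Matrix.mul_inv_rev, Matrix.mulVec_mulVec, Matrix.mul_assoc, Matrix.nonsing_inv_mul _ hu,
      Matrix.mul_one, Matrix.dotProduct_mulVec, ← Matrix.mulVec_transpose,
      Matrix.mulVec_mulVec, Matrix.transpose_nonsing_inv, Matrix.transpose_transpose,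
      Matrix.nonsing_inv_mul _ hu, Matrix.one_mulVec]
  have hd : Real.sqrt ((2 * Real.pi) ^ p * (A * Aᵀ).det)
      = Real.sqrt (2 * Real.pi) ^ p * |A.det| := by
    rw [Matrix.det_mul, Matrix.det_transpose, Real.sqrt_mul (by positivity),
      Real.sqrt_mul_self_eq_abs, Real.sqrt_eq_rpow, Real.sqrt_eq_rpow, ← Real.rpow_natCast,
      ← Real.rpow_natCast, ← Real.rpow_mul (by positivity), ← Real.rpow_mul (by positivity),
      mul_comm (p : ℝ)]
  simp only [normalDensity, hq, hd, gaussianPDFReal_def, NNReal.coe_one, mul_one, sub_zero,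
    Finset.prod_mul_distrib, Finset.prod_const, Finset.card_univ, Fintype.card_fin,
    ← Real.exp_sum]
  have he : -(w ⬝ᵥ w) / 2 = ∑ i, -(w i) ^ 2 / 2 := by
    rw [← Finset.sum_div, Finset.sum_neg_distrib]
    simp [dotProduct, sq]
  rw [he]
  have := abs_ne_zero.2 hA
  field_simp
  rw [← mul_pow, mul_one_div_cancel (by positivity), one_pow]

/-- The substitution z = Aw turns N(0, AA') into the standard normal law; the Jacobian cancels the
determinant in the density. -/
lemma lintegral_normalDensity (A : Matrix (Fin p) (Fin p) ℝ) (hA : A.det ≠ 0)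
    (f : (Fin p → ℝ) → ENNReal) (hf : Measurable f) :
    ∫⁻ z, ENNReal.ofReal (normalDensity (A * Aᵀ) z) * f z =
      ∫⁻ w, f (A *ᵥ w) ∂(stdNormal p) := by
  have hm : Measurable fun w => A *ᵥ w :=
    (show Continuous fun w => A *ᵥ w by fun_prop).measurable
  have hvol : (volume : Measure (Fin p → ℝ)) =
      ENNReal.ofReal |A.det| • Measure.map (fun w => A *ᵥ w) volume := by
    have := Real.map_matrix_volume_pi_eq_smul_volume_pi hA
    have h2 : (⇑(Matrix.toLin' A)) = fun w => A *ᵥ w := by ext w; simp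
    rw [← h2, this, smul_smul, ← ENNReal.ofReal_mul (abs_nonneg _), ← abs_mul,
      mul_inv_cancel₀ hA, abs_one, ENNReal.ofReal_one, one_smul]
  rw [hvol, lintegral_smul_measure, lintegral_map (by fun_prop) hm, stdNormal_eq_withDensity,
    lintegral_withDensity_eq_lintegral_mul _ (by fun_prop)
      (show Measurable fun w => f (A *ᵥ w) from hf.comp hm), smul_eq_mul,
    ← lintegral_const_mul _ (by fun_prop)]
  refine lintegral_congr fun w => ?_
  rw [Pi.mul_apply, ← normalDensity_mulVec A hA, ENNReal.ofReal_mul (abs_nonneg _), mul_assoc]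

lemma exists_eq_mul_transpose {R : Matrix (Fin p) (Fin p) ℝ} (hR : R.PosDef) :
    ∃ A : Matrix (Fin p) (Fin p) ℝ, A.det ≠ 0 ∧ R = A * Aᵀ := by
  open scoped MatrixOrder Matrix.Norms.L2Operator in
  obtain ⟨B, hB, hRB⟩ := CStarAlgebra.isStrictlyPositive_iff_eq_star_mul_self.mp
    hR.isStrictlyPositive
  refine ⟨Bᵀ, ?_, ?_⟩
  · rw [Matrix.det_transpose]
    exact ((Matrix.isUnit_iff_isUnit_det _).1 hB).ne_zero
  · rw [hRB, Matrix.star_eq_conjTranspose, Matrix.transpose_transpose]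
    congr 1

/-- Φ(α'z) is the probability that an independent standard normal U satisfies U ≤ α'z. The
skew-normal weight thus becomes an indicator on an enlarged Gaussian space, where independence
arguments apply. -/
lemma lintegral_skewNormal (A : Matrix (Fin p) (Fin p) ℝ) (hA : A.det ≠ 0) (α : Fin p → ℝ)
    (f : (Fin p → ℝ) → ENNReal) (hf : Measurable f) :
    ∫⁻ z, f z ∂(skewNormal (A * Aᵀ) α) =
      2 * ∫⁻ q, {q : (Fin p → ℝ) × ℝ | q.2 ≤ α ⬝ᵥ (A *ᵥ q.1)}.indicator
        (fun q => f (A *ᵥ q.1)) q ∂((stdNormal p).prod (gaussianReal 0 1)) := by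
  have hα : Measurable fun z : Fin p → ℝ => α ⬝ᵥ z :=
    (show Continuous fun z : Fin p → ℝ => α ⬝ᵥ z by fun_prop).measurable
  have hAm : Measurable fun w : Fin p → ℝ => A *ᵥ w :=
    (show Continuous fun w : Fin p → ℝ => A *ᵥ w by fun_prop).measurable
  have hcdf : Measurable stdNormalCDF := (monotone_cdf _).measurable
  have hset : MeasurableSet {q : (Fin p → ℝ) × ℝ | q.2 ≤ α ⬝ᵥ (A *ᵥ q.1)} :=
    measurableSet_le measurable_snd (hα.comp (hAm.comp measurable_fst))
  have hind : Measurable ({q : (Fin p → ℝ) × ℝ | q.2 ≤ α ⬝ᵥ (A *ᵥ q.1)}.indicator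
      fun q => f (A *ᵥ q.1)) := (hf.comp (hAm.comp measurable_fst)).indicator hset
  have hα' : Measurable fun z : Fin p → ℝ => stdNormalCDF (α ⬝ᵥ z) := hcdf.comp hα
  rw [skewNormal, lintegral_withDensity_eq_lintegral_mul _ (by fun_prop) hf]
  have : ∀ z, ((fun z => ENNReal.ofReal (2 * normalDensity (A * Aᵀ) z *
      stdNormalCDF (α ⬝ᵥ z))) * f) z = 2 * (ENNReal.ofReal (normalDensity (A * Aᵀ) z) *
        (ENNReal.ofReal (stdNormalCDF (α ⬝ᵥ z)) * f z)) := by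
    intro z
    have h0 := normalDensity_nonneg (A * Aᵀ) z
    rw [Pi.mul_apply, ENNReal.ofReal_mul (by positivity), ENNReal.ofReal_mul (by norm_num)]
    simp [mul_assoc]
  simp_rw [this]
  rw [lintegral_const_mul _ (by fun_prop), lintegral_normalDensity A hA _ (by fun_prop),
    lintegral_prod _ hind.aemeasurable]
  congr 1
  refine lintegral_congr fun w => ?_
  have : ∀ u : ℝ, {q : (Fin p → ℝ) × ℝ | q.2 ≤ α ⬝ᵥ (A *ᵥ q.1)}.indicator
        (fun q => f (A *ᵥ q.1)) (w, u) =
      (Set.Iic (α ⬝ᵥ (A *ᵥ w))).indicator (fun _ => f (A *ᵥ w)) u := by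
    intro u
    simp [Set.indicator_apply]
  simp_rw [this]
  rw [lintegral_indicator measurableSet_Iic, lintegral_const, Measure.restrict_apply_univ,
    stdNormalCDF, ofReal_cdf, mul_comm]

/-! ### Linear functionals of a Gaussian vector -/

lemma hasGaussianLaw_id_stdNormal : HasGaussianLaw (fun w : Fin p → ℝ => w) (stdNormal p) := by
  refine iIndepFun.hasGaussianLaw (X := fun i (w : Fin p → ℝ) => w i) (fun i => ?_) ?_
  · refine ⟨?_⟩
    rw [(measurePreserving_eval _ i).map_eq]
    infer_instance
  · exact iIndepFun_pi (X := fun _ x => x) fun _ => aemeasurable_id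

instance isGaussian_stdNormal : IsGaussian (stdNormal p) := by
  simpa using (hasGaussianLaw_id_stdNormal (p := p)).isGaussian_map

/-- A linear functional of a standard Gaussian vector on `ℝ^p × ℝ`. -/
def linForm (u : Fin p → ℝ) (c : ℝ) (q : (Fin p → ℝ) × ℝ) : ℝ := u ⬝ᵥ q.1 + c * q.2

@[fun_prop]
lemma continuous_linForm (u : Fin p → ℝ) (c : ℝ) : Continuous (linForm u c) := by
  unfold linForm; fun_prop

lemma memLp_dotProduct_stdNormal (u : Fin p → ℝ) :
    MemLp (fun w : Fin p → ℝ => u ⬝ᵥ w) 2 (stdNormal p) :=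
  memLp_finsetSum _ fun i _ =>
    ((IsGaussian.memLp_two_id (μ := gaussianReal 0 1)).comp_measurePreserving
      (measurePreserving_eval _ i)).const_mul (u i)

lemma hasGaussianLaw_linForm_prodMk (u v : Fin p → ℝ) (c d : ℝ) :
    HasGaussianLaw (fun q => (linForm u c q, linForm v d q))
      ((stdNormal p).prod (gaussianReal 0 1)) := by
  let L : ((Fin p → ℝ) × ℝ) →ₗ[ℝ] ℝ × ℝ :=
    { toFun := fun q => (linForm u c q, linForm v d q)
      map_add' := by intro x y; simp [linForm, dotProduct_add]; constructor <;> ring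
      map_smul' := by intro r x; simp [linForm]; constructor <;> ring }
  exact (IsGaussian.hasGaussianLaw_id (μ := (stdNormal p).prod (gaussianReal 0 1))).map_fun
    (LinearMap.toContinuousLinearMap L)

lemma variance_linForm (u : Fin p → ℝ) (c : ℝ) :
    Var[linForm u c; (stdNormal p).prod (gaussianReal 0 1)] = u ⬝ᵥ u + c ^ 2 := by
  have h1 : Var[fun w : Fin p → ℝ => u ⬝ᵥ w; stdNormal p] = u ⬝ᵥ u := by
    have := variance_sum_pi (μ := fun _ : Fin p => gaussianReal 0 1)
      (X := fun i x => u i * x) fun i => IsGaussian.memLp_two_id.const_mul (u i)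
    have h2 : (fun w : Fin p → ℝ => u ⬝ᵥ w) = ∑ i, fun w : Fin p → ℝ => u i * w i := by
      ext w; simp [dotProduct]
    rw [h2, this]
    unfold dotProduct
    refine Finset.sum_congr rfl fun i _ => ?_
    rw [variance_const_mul, variance_fun_id_gaussianReal]
    simp [sq]
  have h2 : Var[fun x : ℝ => c * x; gaussianReal 0 1] = c ^ 2 := by
    rw [variance_const_mul, variance_fun_id_gaussianReal]; simp
  have := variance_add_prod (memLp_dotProduct_stdNormal u)
    ((IsGaussian.memLp_two_id (μ := gaussianReal 0 1)).const_mul c)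
  exact this.trans (congrArg₂ _ h1 h2)

lemma memLp_linForm (u : Fin p → ℝ) (c : ℝ) :
    MemLp (linForm u c) 2 ((stdNormal p).prod (gaussianReal 0 1)) :=
  (hasGaussianLaw_linForm_prodMk u u c c).fst.memLp_two

lemma integral_linForm (u : Fin p → ℝ) (c : ℝ) :
    ∫ q, linForm u c q ∂((stdNormal p).prod (gaussianReal 0 1)) = 0 := by
  have hneg : MeasurePreserving (fun x : ℝ => -x) (gaussianReal 0 1) (gaussianReal 0 1) :=
    ⟨measurable_neg, by simpa using gaussianReal_map_neg (μ := 0) (v := 1)⟩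
  have h1 : MeasurePreserving (Prod.map (fun (w : Fin p → ℝ) i => -w i) (fun x : ℝ => -x))
      ((stdNormal p).prod (gaussianReal 0 1)) ((stdNormal p).prod (gaussianReal 0 1)) :=
    (measurePreserving_pi _ _ fun _ => hneg).prod hneg
  have h2 := integral_map (μ := (stdNormal p).prod (gaussianReal 0 1)) h1.measurable.aemeasurable
    (continuous_linForm u c).aestronglyMeasurable
  rw [h1.map_eq] at h2
  have h3 : ∀ q : (Fin p → ℝ) × ℝ,
      linForm u c (Prod.map (fun (w : Fin p → ℝ) i => -w i) (fun x : ℝ => -x) q)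
        = - linForm u c q := by
    intro q
    simp [linForm, dotProduct]; ring
  simp_rw [h3, integral_neg] at h2
  linarith

/-- Polarization of `variance_linForm`, since the sum of two linear forms is again one. -/
lemma covariance_linForm (u v : Fin p → ℝ) (c d : ℝ) :
    cov[linForm u c, linForm v d; (stdNormal p).prod (gaussianReal 0 1)] = u ⬝ᵥ v + c * d := by
  have h := variance_add (memLp_linForm u c) (memLp_linForm v d)
  have h1 : linForm u c + linForm v d = linForm (u + v) (c + d) := by
    ext q; simp [linForm, add_dotProduct]; ring
  rw [h1, variance_linForm, variance_linForm, variance_linForm, add_dotProduct, dotProduct_add,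
    dotProduct_add, dotProduct_comm v u] at h
  linarith

lemma map_linForm (u : Fin p → ℝ) (c : ℝ) :
    Measure.map (linForm u c) ((stdNormal p).prod (gaussianReal 0 1)) =
      gaussianReal 0 (u ⬝ᵥ u + c ^ 2).toNNReal := by
  rw [(hasGaussianLaw_linForm_prodMk u u c c).fst.map_eq_gaussianReal, integral_linForm,
    variance_linForm]

/-- Jointly Gaussian and uncorrelated variables are independent; the hypothesis is the vanishing of
the covariance. -/
lemma map_linForm_prodMk (u v : Fin p → ℝ) (c d : ℝ) (h : u ⬝ᵥ v + c * d = 0) :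
    Measure.map (fun q => (linForm u c q, linForm v d q))
        ((stdNormal p).prod (gaussianReal 0 1)) =
      (gaussianReal 0 (u ⬝ᵥ u + c ^ 2).toNNReal).prod
        (gaussianReal 0 (v ⬝ᵥ v + d ^ 2).toNNReal) := by
  have hi := (hasGaussianLaw_linForm_prodMk u v c d).indepFun_of_covariance_eq_zero
    (by rw [covariance_linForm, h])
  rw [(indepFun_iff_map_prod_eq_prod_map_map (by fun_prop) (by fun_prop)).1 hi, map_linForm,
    map_linForm]

/-! ### Half-normal representation of skew-normal projections -/

/-- The half-normal law, i.e. the law of `|U|` with `U ∼ N(0,1)`. -/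
def halfNormal : Measure ℝ := (2 : ENNReal) • (gaussianReal 0 1).restrict (Set.Ici 0)

/-- With c = √(1 + α'Rα), the variable W = (α'z - U)/c is standard normal and m is its covariance
with a'z. Hence T = a'z - mW is independent of W. The selection event U ≤ α'z is W ≥ 0, so it leaves
T alone and makes W half-normal. -/
lemma map_dotProduct_skewNormal {R : Matrix (Fin p) (Fin p) ℝ} (hR : R.PosDef)
    (α a : Fin p → ℝ) (m : ℝ) (hm : m = a ⬝ᵥ (R *ᵥ α) / Real.sqrt (1 + α ⬝ᵥ (R *ᵥ α))) :
    (skewNormal R α).map (fun z => a ⬝ᵥ z) =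
      ((gaussianReal 0 (a ⬝ᵥ (R *ᵥ a) - m ^ 2).toNNReal).prod halfNormal).map
        fun q => q.1 + m * q.2 := by
  obtain ⟨A, hA, rfl⟩ := exists_eq_mul_transpose hR
  have hdot : ∀ x y : Fin p → ℝ, x ⬝ᵥ ((A * Aᵀ) *ᵥ y) = (Aᵀ *ᵥ x) ⬝ᵥ (Aᵀ *ᵥ y) := by
    intro x y
    rw [← Matrix.mulVec_mulVec, Matrix.dotProduct_mulVec, ← Matrix.mulVec_transpose]
  have hdot' : ∀ x w : Fin p → ℝ, x ⬝ᵥ (A *ᵥ w) = (Aᵀ *ᵥ x) ⬝ᵥ w := by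
    intro x w
    rw [Matrix.dotProduct_mulVec, ← Matrix.mulVec_transpose]
  simp only [hdot] at hm ⊢
  set x := Aᵀ *ᵥ a
  set y := Aᵀ *ᵥ α
  have hy : 0 ≤ y ⬝ᵥ y := by
    simpa using dotProduct_star_self_nonneg y
  set c := Real.sqrt (1 + y ⬝ᵥ y) with hc
  have hc0 : 0 < c := Real.sqrt_pos.2 (by linarith)
  have hcsq : c ^ 2 = 1 + y ⬝ᵥ y := Real.sq_sqrt (by linarith)
  -- the decomposition `a'z = T + m W` with `W = (α'z - U) / c`
  have hlaw := map_linForm_prodMk (x - (m / c) • y) ((1 / c) • y) (m / c) (-(1 / c)) (by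
    simp only [sub_dotProduct, smul_dotProduct, dotProduct_smul, smul_eq_mul]
    have h1 : x ⬝ᵥ y = m * c := by rw [hm]; field_simp
    have h2 : y ⬝ᵥ y = c ^ 2 - 1 := by linarith
    rw [h1, h2]; field_simp; ring)
  have hv1 : (x - (m / c) • y) ⬝ᵥ (x - (m / c) • y) + (m / c) ^ 2 = x ⬝ᵥ x - m ^ 2 := by
    simp only [sub_dotProduct, dotProduct_sub, smul_dotProduct, dotProduct_smul, smul_eq_mul,
      dotProduct_comm y x]
    have h1 : x ⬝ᵥ y = m * c := by rw [hm]; field_simp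
    have h2 : y ⬝ᵥ y = c ^ 2 - 1 := by linarith
    rw [h1, h2]; field_simp; ring
  have hv2 : ((1 / c) • y) ⬝ᵥ ((1 / c) • y) + (-(1 / c)) ^ 2 = 1 := by
    simp only [smul_dotProduct, dotProduct_smul, smul_eq_mul]
    have h2 : y ⬝ᵥ y = c ^ 2 - 1 := by linarith
    rw [h2]; field_simp; ring
  rw [hv1, hv2, Real.toNNReal_one] at hlaw
  refine Measure.ext_of_lintegral _ fun f hf => ?_
  have ha : Measurable fun z : Fin p → ℝ => a ⬝ᵥ z :=
    (show Continuous fun z : Fin p → ℝ => a ⬝ᵥ z by fun_prop).measurable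
  have hg : Measurable ({r : ℝ × ℝ | 0 ≤ r.2}.indicator fun r => f (r.1 + m * r.2)) :=
    (hf.comp (by fun_prop)).indicator (measurableSet_le measurable_const measurable_snd)
  have hsf : SFinite halfNormal := by unfold halfNormal; infer_instance
  rw [lintegral_map hf ha, lintegral_skewNormal A hA α (fun z => f (a ⬝ᵥ z)) (hf.comp ha),
    lintegral_map hf (by fun_prop),
    lintegral_prod (fun r : ℝ × ℝ => f (r.1 + m * r.2)) (by fun_prop)]
  have hrhs : ∀ t : ℝ, ∫⁻ w, f (t + m * w) ∂halfNormal =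
      2 * ∫⁻ w, {r : ℝ × ℝ | 0 ≤ r.2}.indicator (fun r => f (r.1 + m * r.2)) (t, w)
        ∂(gaussianReal 0 1) := by
    intro t
    rw [halfNormal, lintegral_smul_measure, ← lintegral_indicator measurableSet_Ici, smul_eq_mul]
    rfl
  simp_rw [hrhs]
  rw [lintegral_const_mul _ (Measurable.lintegral_prod_right' hg), ← lintegral_prod _ hg.aemeasurable,
    ← hlaw, lintegral_map hg (by fun_prop)]
  congr 1
  refine lintegral_congr fun q => ?_
  have h1 : (q.2 ≤ α ⬝ᵥ (A *ᵥ q.1)) ↔ 0 ≤ linForm ((1 / c) • y) (-(1 / c)) q := by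
    rw [hdot', linForm, smul_dotProduct, smul_eq_mul]
    rw [show 1 / c * (y ⬝ᵥ q.1) + -(1 / c) * q.2 = (y ⬝ᵥ q.1 - q.2) / c by ring]
    rw [le_div_iff₀ hc0, zero_mul, sub_nonneg]
  have h2 : a ⬝ᵥ (A *ᵥ q.1) = linForm (x - (m / c) • y) (m / c) q +
      m * linForm ((1 / c) • y) (-(1 / c)) q := by
    rw [hdot']
    simp only [linForm, sub_dotProduct, smul_dotProduct, smul_eq_mul]
    field_simp
    ring
  simp only [Set.indicator_apply, Set.mem_ofPred_eq, h1, h2]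

/-! ### Moments of the Gaussian and half-normal laws -/

lemma integrable_pow_of_le {μ : Measure ℝ} [IsFiniteMeasure μ] {n : ℕ}
    (h : Integrable (fun x : ℝ => x ^ n) μ) {k : ℕ} (hk : k ≤ n) :
    Integrable (fun x : ℝ => x ^ k) μ := by
  refine ((integrable_const (1 : ℝ)).add h.norm).mono' (by fun_prop) ?_
  refine Filter.Eventually.of_forall fun x => ?_
  simp only [norm_pow, Pi.add_apply]
  rcases le_total ‖x‖ 1 with hx | hx
  · have := pow_le_one₀ (n := k) (norm_nonneg x) hx
    have := pow_nonneg (norm_nonneg x) n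
    linarith
  · have := pow_le_pow_right₀ hx hk
    linarith

lemma integrable_pow_gaussianReal (m : ℝ) (v : NNReal) (k : ℕ) :
    Integrable (fun x : ℝ => x ^ k) (gaussianReal m v) := by
  have h := (memLp_id_gaussianReal (μ := m) (v := v) k).integrable_norm_pow'
  refine (integrable_norm_iff (by fun_prop)).1 ?_
  simpa using h

lemma integrable_pow_halfNormal (k : ℕ) : Integrable (fun x : ℝ => x ^ k) halfNormal :=
  ((integrable_pow_gaussianReal 0 1 k).restrict).smul_measure (by norm_num)

lemma integral_pow_halfNormal (k : ℕ) :
    ∫ x, x ^ k ∂halfNormal = 2 * (Real.sqrt (2 * Real.pi))⁻¹ *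
      ((1 / 2 : ℝ) ^ (-((k : ℝ) + 1) / 2) * (1 / 2) * Real.Gamma (((k : ℝ) + 1) / 2)) := by
  rw [halfNormal, integral_smul_measure, ← integral_rpow_mul_exp_neg_mul_rpow (by norm_num)
    (by have : (0 : ℝ) ≤ k := by positivity
        linarith) (by norm_num), ← integral_indicator measurableSet_Ici,
    integral_gaussianReal_eq_integral_smul one_ne_zero]
  have : (fun x : ℝ => gaussianPDFReal 0 1 x • (Set.Ici 0).indicator (fun x : ℝ => x ^ k) x)
      = (Set.Ici 0).indicator (fun x : ℝ => (Real.sqrt (2 * Real.pi))⁻¹ *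
        (x ^ (k : ℝ) * Real.exp (-(1 / 2) * x ^ (2 : ℝ)))) := by
    ext x
    by_cases hx : x ∈ Set.Ici (0 : ℝ)
    · rw [Set.indicator_of_mem hx, Set.indicator_of_mem hx, gaussianPDFReal_def]
      simp only [NNReal.coe_one, mul_one, sub_zero, smul_eq_mul, Real.rpow_natCast, Real.rpow_two]
      rw [show -x ^ 2 / 2 = -(1 / 2) * x ^ 2 by ring]
      ring
    · rw [Set.indicator_of_notMem hx, Set.indicator_of_notMem hx, smul_zero]
  rw [this, integral_indicator measurableSet_Ici, integral_Ici_eq_integral_Ioi,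
    integral_const_mul]
  simp [mul_assoc]

/-- The mean `√(2/π)` of the half-normal law. -/
def halfNormalMean : ℝ := 2 * (Real.sqrt (2 * Real.pi))⁻¹

lemma halfNormalMean_sq : halfNormalMean ^ 2 = 2 / Real.pi := by
  have := Real.pi_pos
  rw [halfNormalMean, mul_pow, inv_pow, Real.sq_sqrt (by positivity)]
  field_simp

lemma halfNormalMean_pos : 0 < halfNormalMean := by
  have := Real.pi_pos
  unfold halfNormalMean; positivity

lemma half_rpow_neg_half : (1 / 2 : ℝ) ^ (-(1 / 2) : ℝ) = Real.sqrt 2 := by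
  rw [one_div, Real.inv_rpow (by norm_num), Real.rpow_neg (by norm_num), inv_inv,
    Real.sqrt_eq_rpow, one_div]

/-- The total mass is read off from the moment formula with exponent 0. -/
instance isProbabilityMeasure_halfNormal : IsProbabilityMeasure halfNormal := by
  have hfin : IsFiniteMeasure halfNormal :=
    ⟨by simp [halfNormal, ENNReal.mul_lt_top_iff, measure_lt_top]⟩
  have h := integral_pow_halfNormal 0
  have hpi := Real.pi_pos
  simp only [pow_zero, integral_const, smul_eq_mul, mul_one, Nat.cast_zero, zero_add,
    Real.Gamma_one_half_eq, neg_div, half_rpow_neg_half, Real.sqrt_mul zero_le_two] at h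
  have h1 : halfNormal.real Set.univ = 1 := by rw [h]; field_simp
  refine ⟨?_⟩
  rw [Measure.real, ENNReal.toReal_eq_one_iff] at h1
  exact h1

lemma integral_halfNormal : ∫ x, x ^ 1 ∂halfNormal = halfNormalMean := by
  rw [integral_pow_halfNormal 1, halfNormalMean]
  norm_num [Real.rpow_neg_one]

lemma integral_sq_halfNormal : ∫ x, x ^ 2 ∂halfNormal = 1 := by
  have hpi := Real.pi_pos
  have h1 : Real.Gamma (((2 : ℕ) + 1 : ℝ) / 2) = 1 / 2 * Real.sqrt Real.pi := by
    rw [show ((2 : ℕ) + 1 : ℝ) / 2 = 1 / 2 + 1 by norm_num, Real.Gamma_add_one (by norm_num),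
      Real.Gamma_one_half_eq]
  have h2 : (1 / 2 : ℝ) ^ (-((2 : ℕ) + 1 : ℝ) / 2) = 2 * Real.sqrt 2 := by
    rw [show -((2 : ℕ) + 1 : ℝ) / 2 = -1 + -(1 / 2) by norm_num, Real.rpow_add (by norm_num),
      half_rpow_neg_half, Real.rpow_neg_one]
    norm_num
  rw [integral_pow_halfNormal 2, h1, h2, Real.sqrt_mul zero_le_two]
  field_simp

lemma integral_cube_halfNormal : ∫ x, x ^ 3 ∂halfNormal = 2 * halfNormalMean := by
  have h1 : Real.Gamma (((3 : ℕ) + 1 : ℝ) / 2) = 1 := by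
    rw [show ((3 : ℕ) + 1 : ℝ) / 2 = 2 by norm_num, Real.Gamma_two]
  have h2 : (1 / 2 : ℝ) ^ (-((3 : ℕ) + 1 : ℝ) / 2) = 4 := by
    rw [show -((3 : ℕ) + 1 : ℝ) / 2 = -(2 : ℕ) by norm_num, Real.rpow_neg (by norm_num),
      Real.rpow_natCast]
    norm_num
  rw [integral_pow_halfNormal 3, h1, h2, halfNormalMean]
  ring

lemma integral_cube_gaussianReal (v : NNReal) : ∫ x, x ^ 3 ∂(gaussianReal 0 v) = 0 := by
  have h : ∫ x, x ^ 3 ∂((gaussianReal 0 v).map fun x => -x) = ∫ x, (-x) ^ 3 ∂(gaussianReal 0 v) :=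
    integral_map (by fun_prop) (by fun_prop)
  rw [gaussianReal_map_neg, neg_zero] at h
  simp_rw [Odd.neg_pow (by decide : Odd 3), integral_neg] at h
  linarith

lemma integral_sq_gaussianReal (v : NNReal) : ∫ x, x ^ 2 ∂(gaussianReal 0 v) = v := by
  have h := variance_fun_id_gaussianReal (μ := 0) (v := v)
  rw [variance_eq_integral (by fun_prop), integral_id_gaussianReal] at h
  simpa only [sub_zero] using h

lemma integrable_pow_mul_pow_prod {μ ν : Measure ℝ} [SFinite μ] [SFinite ν] {n : ℕ}
    (hμ : ∀ k ≤ n, Integrable (fun x : ℝ => x ^ k) μ)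
    (hν : ∀ k ≤ n, Integrable (fun x : ℝ => x ^ k) ν) {i j : ℕ} (hi : i ≤ n) (hj : j ≤ n) :
    Integrable (fun q : ℝ × ℝ => q.1 ^ i * q.2 ^ j) (μ.prod ν) :=
  (hμ i hi).mul_prod (hν j hj)

lemma integrable_add_mul_pow_prod {μ ν : Measure ℝ} [SFinite μ] [SFinite ν] {n : ℕ}
    (hμ : ∀ k ≤ n, Integrable (fun x : ℝ => x ^ k) μ)
    (hν : ∀ k ≤ n, Integrable (fun x : ℝ => x ^ k) ν) (m : ℝ) :
    Integrable (fun q : ℝ × ℝ => (q.1 + m * q.2) ^ n) (μ.prod ν) := by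
  have h : ∀ q : ℝ × ℝ, (q.1 + m * q.2) ^ n =
      ∑ i ∈ Finset.range (n + 1), m ^ (n - i) * n.choose i * (q.1 ^ i * q.2 ^ (n - i)) := by
    intro q
    rw [add_pow]
    exact Finset.sum_congr rfl fun i _ => by ring
  simp_rw [h]
  exact integrable_finsetSum _ fun i hi => (integrable_pow_mul_pow_prod hμ hν
    (Nat.lt_succ_iff.1 (Finset.mem_range.1 hi)) (Nat.sub_le _ _)).const_mul _

lemma integral_add_mul_pow_prod {μ ν : Measure ℝ} [SFinite μ] [SFinite ν] {n : ℕ}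
    (hμ : ∀ k ≤ n, Integrable (fun x : ℝ => x ^ k) μ)
    (hν : ∀ k ≤ n, Integrable (fun x : ℝ => x ^ k) ν) (m : ℝ) :
    ∫ q, (q.1 + m * q.2) ^ n ∂(μ.prod ν) =
      ∑ i ∈ Finset.range (n + 1), m ^ (n - i) * n.choose i *
        ((∫ x, x ^ i ∂μ) * ∫ y, y ^ (n - i) ∂ν) := by
  have h : ∀ q : ℝ × ℝ, (q.1 + m * q.2) ^ n =
      ∑ i ∈ Finset.range (n + 1), m ^ (n - i) * n.choose i * (q.1 ^ i * q.2 ^ (n - i)) := by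
    intro q
    rw [add_pow]
    exact Finset.sum_congr rfl fun i _ => by ring
  simp_rw [h]
  rw [integral_finsetSum _ fun i hi => (integrable_pow_mul_pow_prod hμ hν
    (Nat.lt_succ_iff.1 (Finset.mem_range.1 hi)) (Nat.sub_le _ _)).const_mul _]
  refine Finset.sum_congr rfl fun i _ => ?_
  rw [integral_const_mul, integral_prod_mul (fun x : ℝ => x ^ i) (fun y : ℝ => y ^ (n - i))]

/-! ### Cauchy–Schwarz and the moments of skew-normal projections -/

/-- The Cauchy–Schwarz inequality for the form of a positive definite matrix, with the case of
equality. -/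
lemma dotProduct_mulVec_sq_le {R : Matrix (Fin p) (Fin p) ℝ} (hR : R.PosDef) {α : Fin p → ℝ}
    (hα : α ≠ 0) (a : Fin p → ℝ) :
    0 < α ⬝ᵥ (R *ᵥ α) ∧ 0 ≤ a ⬝ᵥ (R *ᵥ a) ∧
    (a ⬝ᵥ (R *ᵥ α)) ^ 2 ≤ (a ⬝ᵥ (R *ᵥ a)) * (α ⬝ᵥ (R *ᵥ α)) ∧
    ((a ⬝ᵥ (R *ᵥ α)) ^ 2 = (a ⬝ᵥ (R *ᵥ a)) * (α ⬝ᵥ (R *ᵥ α)) ↔ ∃ t : ℝ, a = t • α) := by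
  have hpos : ∀ x : Fin p → ℝ, x ≠ 0 → 0 < x ⬝ᵥ (R *ᵥ x) := fun x hx => by
    simpa using hR.dotProduct_mulVec_pos hx
  have hnn : ∀ x : Fin p → ℝ, 0 ≤ x ⬝ᵥ (R *ᵥ x) := fun x => by
    simpa using hR.posSemidef.dotProduct_mulVec_nonneg x
  have hsymm : α ⬝ᵥ (R *ᵥ a) = a ⬝ᵥ (R *ᵥ α) := by
    have hT : Rᵀ = R := by simpa using hR.isHermitian.eq
    rw [Matrix.dotProduct_mulVec, ← Matrix.mulVec_transpose, hT, dotProduct_comm]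
  set k := α ⬝ᵥ (R *ᵥ α) with hk
  have hk0 : 0 < k := hpos α hα
  set r := a ⬝ᵥ (R *ᵥ α)
  -- The residual of a after R-orthogonal projection onto α: its form is nonnegative, and zero only
  -- if a = (r/k)α.
  have hexp : (a - (r / k) • α) ⬝ᵥ (R *ᵥ (a - (r / k) • α)) = (a ⬝ᵥ (R *ᵥ a) * k - r ^ 2) / k := by
    simp only [Matrix.mulVec_sub, Matrix.mulVec_smul, sub_dotProduct, dotProduct_sub,
      smul_dotProduct, dotProduct_smul, smul_eq_mul, hsymm, ← hk]
    change a ⬝ᵥ (R *ᵥ a) - r / k * r - r / k * (r - r / k * k) = _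
    field_simp
    ring
  refine ⟨hk0, hnn a, ?_, ?_⟩
  · have h := hnn (a - (r / k) • α)
    rw [hexp, le_div_iff₀ hk0] at h
    linarith
  · constructor
    · intro h
      refine ⟨r / k, ?_⟩
      by_contra hne
      have h2 := hpos (a - (r / k) • α) (sub_ne_zero.2 hne)
      rw [hexp, h, sub_self, zero_div] at h2
      exact lt_irrefl _ h2
    · rintro ⟨t, rfl⟩
      simp only [r, Matrix.mulVec_smul, smul_dotProduct, dotProduct_smul, smul_eq_mul, ← hk]
      ring

lemma moments_dotProduct_skewNormal {R : Matrix (Fin p) (Fin p) ℝ} (hR : R.PosDef)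
    {α : Fin p → ℝ} (hα : α ≠ 0) (a : Fin p → ℝ) (m : ℝ)
    (hm : m = a ⬝ᵥ (R *ᵥ α) / Real.sqrt (1 + α ⬝ᵥ (R *ᵥ α))) (ν : Measure ℝ)
    (hν : ν = (skewNormal R α).map fun z => a ⬝ᵥ z) :
    IsProbabilityMeasure ν ∧ (∀ k, Integrable (fun x : ℝ => x ^ k) ν) ∧
    ∫ x, x ∂ν = halfNormalMean * m ∧ ∫ x, x ^ 2 ∂ν = a ⬝ᵥ (R *ᵥ a) ∧
    ∫ x, x ^ 3 ∂ν = halfNormalMean * (3 * (a ⬝ᵥ (R *ᵥ a)) * m - m ^ 3) := by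
  obtain ⟨hk, hv, hcs, -⟩ := dotProduct_mulVec_sq_le hR hα a
  rw [map_dotProduct_skewNormal hR α a m hm] at hν
  -- By Cauchy–Schwarz the variance of T is nonnegative, so the truncation in `toNNReal` loses
  -- nothing.
  have hτ : 0 ≤ a ⬝ᵥ (R *ᵥ a) - m ^ 2 := by
    rw [hm, div_pow, Real.sq_sqrt (by linarith), sub_nonneg, div_le_iff₀ (by linarith)]
    linarith
  set τ := (a ⬝ᵥ (R *ᵥ a) - m ^ 2).toNNReal
  have hτ' : (τ : ℝ) = a ⬝ᵥ (R *ᵥ a) - m ^ 2 := Real.coe_toNNReal _ hτ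
  have hf : Measurable fun q : ℝ × ℝ => q.1 + m * q.2 := by fun_prop
  have hint := fun k : ℕ => integrable_add_mul_pow_prod (n := k)
    (fun j _ => integrable_pow_gaussianReal 0 τ j) (fun j _ => integrable_pow_halfNormal j) m
  have hmom := fun k : ℕ => integral_add_mul_pow_prod (n := k)
    (fun j _ => integrable_pow_gaussianReal 0 τ j) (fun j _ => integrable_pow_halfNormal j) m
  have hmap : ∀ k : ℕ, ∫ x, x ^ k ∂ν =
      ∫ q, (q.1 + m * q.2) ^ k ∂((gaussianReal 0 τ).prod halfNormal) := fun k => by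
    rw [hν, integral_map hf.aemeasurable (by fun_prop)]
  have hg1 : ∫ x, x ^ 1 ∂(gaussianReal 0 τ) = 0 := by simp [integral_id_gaussianReal]
  have h0 : ∫ x, x ^ 0 ∂halfNormal = 1 := by simp
  have h0' : ∫ x, x ^ 0 ∂(gaussianReal 0 τ) = 1 := by simp
  refine ⟨?_, fun k => ?_, ?_, ?_, ?_⟩
  · rw [hν]; exact Measure.isProbabilityMeasure_map hf.aemeasurable
  · rw [hν]
    exact (integrable_map_measure (by fun_prop) hf.aemeasurable).2 (hint k)
  · have h1 := hmap 1
    simp only [pow_one] at h1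
    have h2 := hmom 1
    simp only [Finset.sum_range_succ, Finset.sum_range_zero, hg1, h0, h0', integral_halfNormal,
      Nat.sub_zero, Nat.sub_self] at h2
    simp only [pow_one] at h2
    rw [h1, h2]; simp; ring
  · rw [hmap 2, hmom 2]
    simp only [Finset.sum_range_succ, Finset.sum_range_zero, hg1, h0, h0', integral_halfNormal,
      integral_sq_halfNormal, integral_sq_gaussianReal, Nat.sub_zero, Nat.sub_self,
      Nat.reduceSub, hτ']
    simp
  · rw [hmap 3, hmom 3]
    simp only [Finset.sum_range_succ, Finset.sum_range_zero, hg1, h0, h0', integral_halfNormal,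
      integral_sq_halfNormal, integral_sq_gaussianReal, integral_cube_gaussianReal,
      integral_cube_halfNormal, Nat.sub_zero, Nat.sub_self, Nat.reduceSub, hτ']
    norm_num [Nat.choose]
    ring

/-! ### Projections as scale mixtures -/

lemma hasLaw_dotProduct {E : Type*} [MeasurableSpace E] {P : Measure E} {ξ : Fin p → ℝ}
    {Om : Matrix (Fin p) (Fin p) ℝ} {α : Fin p → ℝ} {H : Measure ℝ} [SFinite H]
    {X : E → Fin p → ℝ} (hX : HasLaw X (law ξ Om α H) P) (d : Fin p → ℝ) :
    HasLaw (fun e => d ⬝ᵥ X e) ((H.prod ((skewNormal (corrMatrix Om) α).map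
      fun z => (scaleDiag Om *ᵥ d) ⬝ᵥ z)).map fun q => d ⬝ᵥ ξ + q.1 * q.2) P := by
  have hd : ∀ a : Fin p → ℝ, Measurable fun z : Fin p → ℝ => a ⬝ᵥ z := fun a =>
    (show Continuous fun z : Fin p → ℝ => a ⬝ᵥ z by fun_prop).measurable
  have hs : SFinite (skewNormal (corrMatrix Om) α) := by unfold skewNormal; infer_instance
  refine HasLaw.comp (Y := fun z => d ⬝ᵥ z) ⟨(hd d).aemeasurable, ?_⟩ hX
  have h1 : Measurable fun q : ℝ × (Fin p → ℝ) => ξ + scaleDiag Om *ᵥ (q.1 • q.2) :=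
    (show Continuous fun q : ℝ × (Fin p → ℝ) => ξ + scaleDiag Om *ᵥ (q.1 • q.2) by
      fun_prop).measurable
  have h2 : H.prod ((skewNormal (corrMatrix Om) α).map fun z => (scaleDiag Om *ᵥ d) ⬝ᵥ z) =
      (H.prod (skewNormal (corrMatrix Om) α)).map
        (Prod.map id fun z => (scaleDiag Om *ᵥ d) ⬝ᵥ z) := by
    rw [← Measure.map_prod_map _ _ measurable_id (hd _), Measure.map_id]
  rw [law, h2, Measure.map_map (hd d) h1,
    Measure.map_map (by fun_prop) (measurable_id.prodMap (hd _))]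
  congr 1
  ext q
  have hT : (scaleDiag Om)ᵀ = scaleDiag Om := Matrix.diagonal_transpose _
  simp only [Function.comp_apply, Prod.map_fst, Prod.map_snd, id, dotProduct_add,
    Matrix.mulVec_smul, dotProduct_smul, smul_eq_mul]
  rw [Matrix.dotProduct_mulVec, ← Matrix.mulVec_transpose, hT]

/-- The common shape of the expanded polynomials of degree at most three integrated below; a zero
coefficient covers lower degrees. -/
lemma integral_linear_combination {S : Type*} [MeasurableSpace S] {μ : Measure S}
    [IsProbabilityMeasure μ] {f g h : S → ℝ} (hf : Integrable f μ) (hg : Integrable g μ)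
    (hh : Integrable h μ) (a b c d : ℝ) :
    ∫ x, (a * f x + b * g x + c * h x + d) ∂μ =
      a * ∫ x, f x ∂μ + b * ∫ x, g x ∂μ + c * ∫ x, h x ∂μ + d := by
  have h1 := hf.const_mul a
  have h2 := hg.const_mul b
  have h3 := hh.const_mul c
  have h12 : Integrable (fun x => a * f x + b * g x) μ := h1.add h2
  have h123 : Integrable (fun x => a * f x + b * g x + c * h x) μ := h12.add h3
  rw [integral_add h123 (integrable_const d), integral_add h12 h3, integral_add h1 h2,
    integral_const_mul, integral_const_mul, integral_const_mul]
  simp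

lemma moments_scale_mixture {E : Type*} [MeasurableSpace E] {P : Measure E}
    [IsProbabilityMeasure P] {H ν : Measure ℝ} [IsProbabilityMeasure H] [IsProbabilityMeasure ν]
    (hH : ∀ k ≤ 3, Integrable (fun x : ℝ => x ^ k) H)
    (hν : ∀ k ≤ 3, Integrable (fun x : ℝ => x ^ k) ν) {c : ℝ} {Y : E → ℝ}
    (hY : HasLaw Y ((H.prod ν).map fun q => c + q.1 * q.2) P) :
    MemLp Y 2 P ∧
    Var[Y; P] = (∫ x, x ^ 2 ∂H) * (∫ x, x ^ 2 ∂ν) - ((∫ x, x ∂H) * ∫ x, x ∂ν) ^ 2 ∧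
    ∫ e, (Y e - ∫ e', Y e' ∂P) ^ 3 ∂P = (∫ x, x ^ 3 ∂H) * (∫ x, x ^ 3 ∂ν)
      - 3 * ((∫ x, x ^ 2 ∂H) * ∫ x, x ^ 2 ∂ν) * ((∫ x, x ∂H) * ∫ x, x ∂ν)
      + 2 * ((∫ x, x ∂H) * ∫ x, x ∂ν) ^ 3 := by
  have hf : Measurable fun q : ℝ × ℝ => c + q.1 * q.2 := by fun_prop
  have hcomp : ∀ f : ℝ → ℝ, Continuous f → ∫ e, f (Y e) ∂P = ∫ q, f (c + q.1 * q.2) ∂(H.prod ν) := by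
    intro f hfc
    rw [← integral_map hf.aemeasurable hfc.aestronglyMeasurable]
    exact hY.integral_comp hfc.aestronglyMeasurable
  have hi : ∀ k ≤ 3, Integrable (fun q : ℝ × ℝ => (q.1 * q.2) ^ k) (H.prod ν) := by
    intro k hk
    simp_rw [mul_pow]
    exact integrable_pow_mul_pow_prod hH hν hk hk
  have hm : ∀ k : ℕ, ∫ q, (q.1 * q.2) ^ k ∂(H.prod ν) = (∫ x, x ^ k ∂H) * ∫ x, x ^ k ∂ν := by
    intro k
    simp_rw [mul_pow]
    exact integral_prod_mul (fun x : ℝ => x ^ k) (fun x : ℝ => x ^ k)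
  have hi1 : Integrable (fun q : ℝ × ℝ => q.1 * q.2) (H.prod ν) := by
    simpa using hi 1 (by norm_num)
  have hm1 : ∫ q, q.1 * q.2 ∂(H.prod ν) = (∫ x, x ∂H) * ∫ x, x ∂ν := by simpa using hm 1
  have hi2 := hi 2 (by norm_num)
  have hi3 := hi 3 le_rfl
  set M := (∫ x, x ∂H) * ∫ x, x ∂ν
  have hmean : ∫ e, Y e ∂P = c + M := by
    rw [hcomp (fun x => x) continuous_id, integral_add (integrable_const _) hi1, hm1]
    simp
  have hmem : MemLp (fun q : ℝ × ℝ => c + q.1 * q.2) 2 (H.prod ν) := by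
    refine (memLp_const c).add ((memLp_two_iff_integrable_sq (by fun_prop)).2 hi2)
  refine ⟨?_, ?_, ?_⟩
  · have h1 : MemLp (fun x : ℝ => x) 2 ((H.prod ν).map fun q => c + q.1 * q.2) :=
      (memLp_map_measure_iff (by fun_prop) hf.aemeasurable).2 hmem
    rw [← hY.map_eq] at h1
    exact (memLp_map_measure_iff (by fun_prop) hY.aemeasurable).1 h1
  · rw [variance_eq_integral hY.aemeasurable, hmean, hcomp (fun x => (x - (c + M)) ^ 2)
      (by fun_prop), ← hm 2]
    have : ∀ q : ℝ × ℝ, (c + q.1 * q.2 - (c + M)) ^ 2 =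
        0 * (q.1 * q.2) ^ 3 + 1 * (q.1 * q.2) ^ 2 + (-(2 * M)) * (q.1 * q.2) + M ^ 2 :=
      fun q => by ring
    simp_rw [this]
    rw [integral_linear_combination hi3 hi2 hi1, hm1]
    ring
  · rw [hmean, hcomp (fun x => (x - (c + M)) ^ 3) (by fun_prop), ← hm 2, ← hm 3]
    have : ∀ q : ℝ × ℝ, (c + q.1 * q.2 - (c + M)) ^ 3 =
        1 * (q.1 * q.2) ^ 3 + (-(3 * M)) * (q.1 * q.2) ^ 2 + (3 * M ^ 2) * (q.1 * q.2) + (-M ^ 3) :=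
      fun q => by ring
    simp_rw [this]
    rw [integral_linear_combination hi3 hi2 hi1, hm1]
    ring

/-! ### Covariance and scale matrices -/

lemma dotProduct_covMatrix {E : Type*} [MeasurableSpace E] {P : Measure E}
    [IsProbabilityMeasure P] {X : E → Fin p → ℝ} (hX : ∀ i, MemLp (fun e => X e i) 2 P)
    (d : Fin p → ℝ) :
    d ⬝ᵥ (covMatrix P X *ᵥ d) = Var[fun e => d ⬝ᵥ X e; P] := by
  have hm : ∀ i, MemLp (fun e => d i * X e i) 2 P := fun i => (hX i).const_mul _
  have hae : AEMeasurable (fun e => d ⬝ᵥ X e) P :=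
    (memLp_finsetSum Finset.univ fun i _ => hm i).aestronglyMeasurable.aemeasurable
  rw [← covariance_self hae]
  simp only [dotProduct, Matrix.mulVec]
  rw [covariance_fun_sum_fun_sum hm hm]
  refine Finset.sum_congr rfl fun i _ => ?_
  rw [Finset.mul_sum]
  refine Finset.sum_congr rfl fun j _ => ?_
  rw [covariance_const_mul_left, covariance_const_mul_right, covMatrix, Matrix.of_apply]
  ring

lemma scaleDiag_pos {Om : Matrix (Fin p) (Fin p) ℝ} (hOm : Om.PosDef) (i : Fin p) :
    0 < Real.sqrt (Om i i) :=
  Real.sqrt_pos.2 hOm.diag_pos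

lemma isUnit_det_scaleDiag {Om : Matrix (Fin p) (Fin p) ℝ} (hOm : Om.PosDef) :
    IsUnit (scaleDiag Om).det := by
  rw [scaleDiag, Matrix.det_diagonal, isUnit_iff_ne_zero]
  exact Finset.prod_ne_zero_iff.2 fun i _ => (scaleDiag_pos hOm i).ne'

lemma posDef_corrMatrix {Om : Matrix (Fin p) (Fin p) ℝ} (hOm : Om.PosDef) :
    (corrMatrix Om).PosDef := by
  have hu := isUnit_det_scaleDiag hOm
  have hT : ((scaleDiag Om)⁻¹)ᴴ = (scaleDiag Om)⁻¹ := by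
    rw [Matrix.conjTranspose_nonsing_inv, scaleDiag, Matrix.diagonal_conjTranspose]
    simp
  have hinj : Function.Injective ((scaleDiag Om)⁻¹).mulVec :=
    Matrix.mulVec_injective_iff_isUnit.2
      ((Matrix.isUnit_iff_isUnit_det _).2 (Matrix.isUnit_nonsing_inv_det _ hu))
  have := hOm.conjTranspose_mul_mul_same hinj
  rwa [hT] at this

lemma scaleDiag_mulVec_eq_smul_iff {Om : Matrix (Fin p) (Fin p) ℝ} (hOm : Om.PosDef)
    (α d : Fin p → ℝ) (c : ℝ) : scaleDiag Om *ᵥ d = c • α ↔ d = c • shape Om α := by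
  have hu := isUnit_det_scaleDiag hOm
  rw [shape, ← Matrix.mulVec_smul]
  constructor
  · intro h
    rw [← h, Matrix.mulVec_mulVec, Matrix.nonsing_inv_mul _ hu, Matrix.one_mulVec]
  · intro h
    rw [h, Matrix.mulVec_mulVec, Matrix.mul_nonsing_inv _ hu, Matrix.one_mulVec]

/-! ### Inequalities for the mixing moments -/

/-- The two inequalities come from integrating (S - s₁)² and S(s₁S - s₂)²; the latter is nonnegative
because S ≥ 0 almost surely. -/
lemma moment_inequalities {H : Measure ℝ} [IsProbabilityMeasure H]
    (hH_nonneg : H (Set.Iio 0) = 0) (hH_ne : H (Set.Ioi 0) ≠ 0)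
    (hH : ∀ k ≤ 3, Integrable (fun x : ℝ => x ^ k) H) :
    0 < ∫ s, s ∂H ∧ (∫ s, s ∂H) ^ 2 ≤ ∫ s, s ^ 2 ∂H ∧
      (∫ s, s ^ 2 ∂H) ^ 2 ≤ (∫ s, s ∂H) * ∫ s, s ^ 3 ∂H := by
  have hae : ∀ᵐ s ∂H, 0 ≤ s := by
    rw [ae_iff]
    simpa [Set.Iio] using hH_nonneg
  have hi1 : Integrable (fun x : ℝ => x) H := by simpa using hH 1 (by norm_num)
  have hi2 := hH 2 (by norm_num)
  have hi3 := hH 3 le_rfl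
  set s1 := ∫ s, s ∂H
  have hs1 : 0 < s1 := by
    refine (integral_pos_iff_support_of_nonneg_ae hae hi1).2 ?_
    refine (pos_iff_ne_zero.2 hH_ne).trans_le (measure_mono fun x hx => ?_)
    exact (ne_of_gt hx : x ≠ 0)
  refine ⟨hs1, ?_, ?_⟩
  · have h : 0 ≤ ∫ s, (s - s1) ^ 2 ∂H := integral_nonneg fun s => sq_nonneg _
    have hexp : ∀ s : ℝ, (s - s1) ^ 2 = 0 * s ^ 3 + 1 * s ^ 2 + (-(2 * s1)) * s + s1 ^ 2 :=
      fun s => by ring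
    simp_rw [hexp] at h
    rw [integral_linear_combination hi3 hi2 hi1] at h
    change 0 ≤ 0 * (∫ s, s ^ 3 ∂H) + 1 * (∫ s, s ^ 2 ∂H) + -(2 * s1) * s1 + s1 ^ 2 at h
    linarith
  · set s2 := ∫ s, s ^ 2 ∂H
    have h : 0 ≤ ∫ s, s * (s1 * s - s2) ^ 2 ∂H := by
      refine integral_nonneg_of_ae ?_
      filter_upwards [hae] with s hs
      exact mul_nonneg hs (sq_nonneg _)
    have hexp : ∀ s : ℝ, s * (s1 * s - s2) ^ 2 =
        s1 ^ 2 * s ^ 3 + (-(2 * s1 * s2)) * s ^ 2 + s2 ^ 2 * s + 0 := fun s => by ring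
    simp_rw [hexp] at h
    rw [integral_linear_combination hi3 hi2 hi1] at h
    change 0 ≤ s1 ^ 2 * (∫ s, s ^ 3 ∂H) + -(2 * s1 * s2) * s2 + s2 ^ 2 * s1 + 0 at h
    have h2 : 0 ≤ s1 * (s1 * (∫ s, s ^ 3 ∂H) - s2 ^ 2) := by linarith
    have := nonneg_of_mul_nonneg_right h2 hs1
    linarith

/-- The coefficients in the skewness of a projection, as a cubic in its skewing parameter. -/
lemma skewness_coeff_nonneg {s1 s2 s3 b : ℝ} (hs1 : 0 < s1) (h12 : s1 ^ 2 ≤ s2)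
    (h123 : s2 ^ 2 ≤ s1 * s3) (hb : 1 / 2 < b ^ 2) (hmom : s2 ≤ 2 * b ^ 2 * s1 ^ 2) :
    0 ≤ 3 * (s3 - s1 * s2) ∧ 0 ≤ s3 * (3 * b ^ 2 * s1 ^ 2 - s2) - b ^ 2 * s1 ^ 3 * s2 ∧
      (0 < 3 * (s3 - s1 * s2) ∨
        0 < s3 * (3 * b ^ 2 * s1 ^ 2 - s2) - b ^ 2 * s1 ^ 3 * s2) := by
  have hs2 : 0 < s2 := lt_of_lt_of_le (by positivity) h12
  have hA : s1 * s2 ≤ s3 := by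
    have : s1 * (s1 * s2) ≤ s1 * s3 := by nlinarith
    exact le_of_mul_le_mul_left this hs1
  have hc : 0 < 3 * b ^ 2 * s1 ^ 2 - s2 := by nlinarith [sq_nonneg s1]
  -- Replacing s₃ by its lower bound s₁s₂ leaves the factor 2b²s₁² - s₂, whose sign is the moment
  -- condition.
  have hB : s1 * s2 * (2 * b ^ 2 * s1 ^ 2 - s2) ≤
      s3 * (3 * b ^ 2 * s1 ^ 2 - s2) - b ^ 2 * s1 ^ 3 * s2 := by
    have := mul_le_mul_of_nonneg_right hA hc.le
    linarith
  have hp : 0 < s1 * s2 := by positivity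
  refine ⟨by linarith, (mul_nonneg hp.le (by linarith)).trans hB, ?_⟩
  rcases hA.lt_or_eq with h | h
  · left; linarith
  -- If s₃ = s₁s₂, then `h123` forces s₂ ≤ s₁², and b² > 1/2 makes the factor 2b²s₁² - s₂ strictly
  -- positive.
  · right
    refine lt_of_lt_of_le (mul_pos hp ?_) hB
    have h2 : s2 * s2 ≤ s1 ^ 2 * s2 := by rw [← h] at h123; linarith
    have h3 : s2 ≤ s1 ^ 2 := le_of_mul_le_mul_right h2 hs2
    have h4 : 0 < s1 ^ 2 := by positivity
    nlinarith

/-- Strictness comes from the factor x; the square only has to be nondecreasing, and positive at the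
larger point. -/
lemma strictMonoOn_mul_sq {A B b : ℝ} (hA : 0 ≤ A) (hB : 0 ≤ B) (hAB : 0 < A ∨ 0 < B)
    (hb : 0 < b) : StrictMonoOn (fun x : ℝ => b * x * (A + B * x) ^ 2) (Set.Ici 0) := by
  intro x hx y hy hxy
  have hx0 : (0 : ℝ) ≤ x := hx
  have hy0 : 0 < y := hx0.trans_lt hxy
  have h1 : A + B * x ≤ A + B * y := by
    have := mul_le_mul_of_nonneg_left hxy.le hB
    linarith
  have h2 : 0 < A + B * y := by
    rcases hAB with h | h <;> positivity
  have h3 : 0 ≤ A + B * x := by positivity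
  have h4 : (A + B * x) ^ 2 ≤ (A + B * y) ^ 2 := pow_le_pow_left₀ h3 h1 2
  calc b * x * (A + B * x) ^ 2 ≤ b * x * (A + B * y) ^ 2 :=
        mul_le_mul_of_nonneg_left h4 (by positivity)
    _ < b * y * (A + B * y) ^ 2 :=
        mul_lt_mul_of_pos_right (mul_lt_mul_of_pos_left hxy hb) (by positivity)

/-- Mean-centred moments of the projections of a scale mixture of skew-normal laws. -/
lemma projection_moments {E : Type*} [MeasurableSpace E] {P : Measure E} [IsProbabilityMeasure P]
    {ξ : Fin p → ℝ} {Om : Matrix (Fin p) (Fin p) ℝ} (hOm : Om.PosDef) {α : Fin p → ℝ}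
    (hα : α ≠ 0) {H : Measure ℝ} [IsProbabilityMeasure H]
    (hH : ∀ k ≤ 3, Integrable (fun x : ℝ => x ^ k) H) {X : E → Fin p → ℝ}
    (hX : HasLaw X (law ξ Om α H) P) (d a : Fin p → ℝ) (ha : a = scaleDiag Om *ᵥ d) (v m : ℝ)
    (hv : v = a ⬝ᵥ (corrMatrix Om *ᵥ a))
    (hm : m = a ⬝ᵥ (corrMatrix Om *ᵥ α) / Real.sqrt (1 + α ⬝ᵥ (corrMatrix Om *ᵥ α))) :
    MemLp (fun e => d ⬝ᵥ X e) 2 P ∧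
    Var[fun e => d ⬝ᵥ X e; P] =
      (∫ s, s ^ 2 ∂H) * v - ((∫ s, s ∂H) * (halfNormalMean * m)) ^ 2 ∧
    ∫ e, (d ⬝ᵥ X e - ∫ e', d ⬝ᵥ X e' ∂P) ^ 3 ∂P =
      (∫ s, s ^ 3 ∂H) * (halfNormalMean * (3 * v * m - m ^ 3))
      - 3 * ((∫ s, s ^ 2 ∂H) * v) * ((∫ s, s ∂H) * (halfNormalMean * m))
      + 2 * ((∫ s, s ∂H) * (halfNormalMean * m)) ^ 3 := by
  obtain ⟨hprob, hint, h1, h2, h3⟩ :=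
    moments_dotProduct_skewNormal (posDef_corrMatrix hOm) hα a m hm _ rfl
  have hlaw := hasLaw_dotProduct hX d
  rw [← ha] at hlaw
  have := moments_scale_mixture hH (fun k _ => hint k) hlaw
  rwa [h1, h2, h3, ← hv] at this

end SMSN

end

/-! ### The maximization -/

open SMSN in
theorem theorem1 {p : ℕ} {E : Type*} [MeasurableSpace E] (P : Measure E) [IsProbabilityMeasure P]
    (ξ : Fin p → ℝ) (Om : Matrix (Fin p) (Fin p) ℝ) (hOm : Om.PosDef)
    (α : Fin p → ℝ) (hα : α ≠ 0)
    (H : Measure ℝ) [IsProbabilityMeasure H]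
    (hH_nonneg : H (Set.Iio 0) = 0) (hH_ne : H (Set.Ioi 0) ≠ 0)
    (hH_third : Integrable (fun s : ℝ => s ^ 3) H)
    (hmoment : (∫ s, s ^ 2 ∂H) ≤ 4 / Real.pi * (∫ s, s ∂H) ^ 2)
    (X : E → Fin p → ℝ) (hX : HasLaw X (SMSN.law ξ Om α H) P) :
    (∃ d ∈ SMSN.directions P X, ∃ c : ℝ, d = c • SMSN.shape Om α) ∧
    ∀ d ∈ SMSN.directions P X,
      (IsMaxOn (fun d' => SMSN.skewness P fun e => d' ⬝ᵥ X e) (SMSN.directions P X) d ↔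
        ∃ c : ℝ, d = c • SMSN.shape Om α) := by
  have hH : ∀ k ≤ 3, Integrable (fun x : ℝ => x ^ k) H := fun k hk =>
    integrable_pow_of_le hH_third hk
  obtain ⟨hs1, h12, h123⟩ := moment_inequalities hH_nonneg hH_ne hH
  have hpm := fun d => projection_moments hOm hα hH hX d _ rfl _ _ rfl rfl
  have hcs := fun a => dotProduct_mulVec_sq_le (posDef_corrMatrix hOm) hα a
  have hk0 := (hcs α).1
  set s1 := ∫ s, s ∂H
  set s2 := ∫ s, s ^ 2 ∂H
  set s3 := ∫ s, s ^ 3 ∂H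
  set b := halfNormalMean
  set k := α ⬝ᵥ (corrMatrix Om *ᵥ α)
  have hb : 0 < b := halfNormalMean_pos
  have hb2 : b ^ 2 = 2 / Real.pi := halfNormalMean_sq
  have hpi3 := Real.pi_gt_three
  have hpi4 := Real.pi_lt_four
  have hbl : 1 / 2 < b ^ 2 := by
    rw [hb2, div_lt_div_iff₀ (by norm_num) (by linarith)]; linarith
  have hbu : b ^ 2 < 1 := by
    rw [hb2, div_lt_one (by linarith)]; linarith
  have hs2 : 0 < s2 := lt_of_lt_of_le (by positivity) h12
  obtain ⟨hA, hB, hAB⟩ := skewness_coeff_nonneg hs1 h12 h123 hbl (by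
    rw [hb2]; calc s2 ≤ _ := hmoment
      _ = _ := by ring)
  set A := 3 * (s3 - s1 * s2)
  set B := s3 * (3 * b ^ 2 * s1 ^ 2 - s2) - b ^ 2 * s1 ^ 3 * s2
  have hmono := strictMonoOn_mul_sq hA hB hAB (b := b ^ 2) (by positivity)
  set G : ℝ → ℝ := fun x => b ^ 2 * x * (A + B * x) ^ 2
  -- the quadratic form, the skewing parameter, and its square
  let v : (Fin p → ℝ) → ℝ := fun d =>
    (scaleDiag Om *ᵥ d) ⬝ᵥ (corrMatrix Om *ᵥ (scaleDiag Om *ᵥ d))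
  let m : (Fin p → ℝ) → ℝ := fun d =>
    (scaleDiag Om *ᵥ d) ⬝ᵥ (corrMatrix Om *ᵥ α) / Real.sqrt (1 + k)
  have hk1 : (0 : ℝ) < 1 + k := by linarith
  have hmsq : ∀ d, m d ^ 2 * (1 + k) = ((scaleDiag Om *ᵥ d) ⬝ᵥ (corrMatrix Om *ᵥ α)) ^ 2 := by
    intro d
    simp only [m]
    rw [div_pow, Real.sq_sqrt hk1.le]
    field_simp
  have hle : ∀ d, m d ^ 2 * (1 + k) ≤ v d * k := fun d => by
    rw [hmsq]; exact (hcs _).2.2.1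
  have heq : ∀ d, m d ^ 2 * (1 + k) = v d * k ↔ ∃ c : ℝ, d = c • shape Om α := fun d => by
    rw [hmsq, (hcs _).2.2.2]
    exact exists_congr fun c => scaleDiag_mulVec_eq_smul_iff hOm α d c
  -- A coordinate is the projection along a standard basis vector.
  have hcoord : ∀ i, MemLp (fun e => X e i) 2 P := fun i => by
    simpa using (hpm (Pi.single i 1)).1
  have hvar : ∀ d, d ⬝ᵥ (covMatrix P X *ᵥ d) = s2 * v d - (s1 * (b * m d)) ^ 2 := fun d => by
    rw [dotProduct_covMatrix hcoord]; exact (hpm d).2.1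
  have hdir : ∀ d, d ∈ directions P X ↔ s2 * v d - (s1 * (b * m d)) ^ 2 = 1 := fun d => by
    rw [← hvar]; rfl
  -- The factor s₂² clears the denominator that arises when the constraint is used to eliminate v.
  have hskew : ∀ d ∈ directions P X,
      s2 ^ 2 * skewness P (fun e => d ⬝ᵥ X e) = G (m d ^ 2) := by
    intro d hd
    have hd' := (hdir d).1 hd
    have hV : Var[fun e => d ⬝ᵥ X e; P] = 1 := by
      rw [← dotProduct_covMatrix hcoord]; exact hd
    rw [skewness, hV, Real.sqrt_one]
    simp only [div_one]
    rw [(hpm d).2.2]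
    change s2 ^ 2 * (s3 * (b * (3 * v d * m d - m d ^ 3)) - 3 * (s2 * v d) * (s1 * (b * m d))
      + 2 * (s1 * (b * m d)) ^ 3) ^ 2 = b ^ 2 * m d ^ 2 * (A + B * m d ^ 2) ^ 2
    have hv : s2 * v d = 1 + b ^ 2 * s1 ^ 2 * m d ^ 2 := by linarith
    have key : s2 * (s3 * (b * (3 * v d * m d - m d ^ 3)) - 3 * (s2 * v d) * (s1 * (b * m d))
        + 2 * (s1 * (b * m d)) ^ 3) = b * m d * (A + B * m d ^ 2) := by
      have : s2 * (s3 * (b * (3 * v d * m d - m d ^ 3)) - 3 * (s2 * v d) * (s1 * (b * m d))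
          + 2 * (s1 * (b * m d)) ^ 3) = s3 * b * (3 * (s2 * v d) * m d - s2 * m d ^ 3)
          - 3 * s2 * (s2 * v d) * (s1 * (b * m d)) + 2 * s2 * (s1 * (b * m d)) ^ 3 := by ring
      rw [this, hv]
      simp only [A, B]
      ring
    rw [← mul_pow, key]
    ring
  -- on the directions, the squared skewing parameter is maximal exactly at the shape vector
  have hden : 0 < s2 * (1 + k) - b ^ 2 * s1 ^ 2 * k := by
    have h1 : b ^ 2 * s1 ^ 2 ≤ 1 * s2 := mul_le_mul hbu.le h12 (sq_nonneg _) zero_le_one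
    have h2 := mul_le_mul_of_nonneg_right h1 hk0.le
    linarith
  set D := s2 * (1 + k) - b ^ 2 * s1 ^ 2 * k
  -- Multiplying the constraint by k turns the Cauchy–Schwarz deficit into the deficit of m² from
  -- k/D.
  have hgap : ∀ d ∈ directions P X, k - m d ^ 2 * D = s2 * (v d * k - m d ^ 2 * (1 + k)) := by
    intro d hd
    have hd' := (hdir d).1 hd
    simp only [D]
    linear_combination (-k) * hd'
  have hxle : ∀ d ∈ directions P X, m d ^ 2 ≤ k / D := by
    intro d hd
    rw [le_div_iff₀ hden, ← sub_nonneg, hgap d hd]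
    exact mul_nonneg hs2.le (sub_nonneg.2 (hle d))
  have hxeq : ∀ d ∈ directions P X, (m d ^ 2 = k / D ↔ ∃ c : ℝ, d = c • shape Om α) := by
    intro d hd
    rw [← heq, eq_div_iff hden.ne', eq_comm, ← sub_eq_zero, hgap d hd, mul_eq_zero,
      or_iff_right hs2.ne', sub_eq_zero, eq_comm]
  have hex : ∃ d ∈ directions P X, ∃ c : ℝ, d = c • shape Om α := by
    set η := shape Om α
    have hη : scaleDiag Om *ᵥ η = α := by
      simpa using (scaleDiag_mulVec_eq_smul_iff hOm α η 1).2 (one_smul ℝ _).symm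
    set w := η ⬝ᵥ (covMatrix P X *ᵥ η) with hw
    -- Equality in Cauchy–Schwarz at η gives Var(η'X) = kD/(1+k) > 0, so η can be rescaled to unit
    -- variance.
    have hw0 : 0 < w := by
      have h1 : v η = k := by simp only [v, hη]; rfl
      have h2 : m η ^ 2 * (1 + k) = k * k := by rw [(heq η).2 ⟨1, (one_smul ℝ _).symm⟩, h1]
      have h3 : w * (1 + k) = k * D := by
        rw [hw, hvar, h1]
        calc _ = s2 * k * (1 + k) - s1 ^ 2 * b ^ 2 * (m η ^ 2 * (1 + k)) := by ring
          _ = _ := by rw [h2]; simp only [D]; ring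
      exact pos_of_mul_pos_left (h3 ▸ mul_pos hk0 hden) hk1.le
    refine ⟨(Real.sqrt w)⁻¹ • η, ?_, _, rfl⟩
    change _ = _
    rw [Matrix.mulVec_smul, smul_dotProduct, dotProduct_smul, ← hw, smul_eq_mul, smul_eq_mul,
      ← mul_assoc, ← mul_inv, Real.mul_self_sqrt hw0.le, inv_mul_cancel₀ hw0.ne']
  refine ⟨hex, fun d hd => ?_⟩
  have hs22 : 0 < s2 ^ 2 := by positivity
  rw [← hxeq d hd]
  constructor
  · intro hmax
    obtain ⟨d₀, hd₀, hc⟩ := hex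
    have h0 := (hxeq d₀ hd₀).2 hc
    have h1 := mul_le_mul_of_nonneg_left (hmax hd₀) hs22.le
    simp only [hskew d hd, hskew d₀ hd₀] at h1
    -- Strict monotonicity reflects the inequality: a maximizer has m² at least the value k/D
    -- reached along η.
    have h2 := (hmono.le_iff_le (sq_nonneg (m d₀)) (sq_nonneg (m d))).1 h1
    exact le_antisymm (hxle d hd) (h0 ▸ h2)
  · intro hx d' hd'
    refine le_of_mul_le_mul_left ?_ hs22
    simp only [hskew d hd, hskew d' hd']
    exact hmono.monotoneOn (sq_nonneg (m d')) (sq_nonneg (m d)) (hx ▸ hxle d' hd')
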